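/- Let $f\in C^\infty(\mathbb{R}^n)$ be convex with $\lim_{|x|\to\infty} f(x)/|x|=+\infty$, and let $\delta>0$. Let $u_\delta\in C(\mathbb{R}^n)$ be a viscosity solution of $$\max\{\delta u-\Delta u-f,\ |Du|-1\}=0 \quad\text{in } \mathbb{R}^n$$ satisfying $\lim_{|x|\to\infty}u_\delta(x)/|x|=1$. That is, for every $x_0\in\mathbb{R}^n$ and every $\varphi\in C^2(\mathbb{R}^n)$, $$\max\{\delta u_\delta(x_0)-\Delta\varphi(x_0)-f(x_0),\ |D\varphi(x_0)|-1\}\le 0 \quad\text{if } u_\delta-\varphi \text{ has a local maximum at } x_0,$$ and the same maximum is $\ge 0$ if $u_\delta-\varphi$ has a local minimum at $x_0$. Then $u_\delta$ is convex. -/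

import Mathlib

open Filter Topology
open scoped Laplacian Gradient ContDiff

/-- The left-hand side `max {δ r - Δφ(x) - f(x), |Dφ(x)| - 1}` of the discounted
gradient-constrained equation, with the derivatives taken from `φ` at `x` and the value `r` in
place of the zeroth-order term. -/
noncomputable def discountedOp {n : ℕ} (δ : ℝ) (f : EuclideanSpace ℝ (Fin n) → ℝ)
    (r : ℝ) (φ : EuclideanSpace ℝ (Fin n) → ℝ) (x : EuclideanSpace ℝ (Fin n)) : ℝ :=
  max (δ * r - Δ φ x - f x) (‖∇ φ x‖ - 1)

/-- `u` is a viscosity subsolution of `max {δ u - Δu - f, |Du| - 1} = 0` on `ℝⁿ`. -/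
def IsDiscountedSubsolution {n : ℕ} (δ : ℝ) (f u : EuclideanSpace ℝ (Fin n) → ℝ) : Prop :=
  UpperSemicontinuous u ∧
    ∀ (x₀ : EuclideanSpace ℝ (Fin n)) (φ : EuclideanSpace ℝ (Fin n) → ℝ),
      ContDiff ℝ 2 φ → IsLocalMax (fun x => u x - φ x) x₀ → discountedOp δ f (u x₀) φ x₀ ≤ 0

/-- `v` is a viscosity supersolution of `max {δ v - Δv - f, |Dv| - 1} = 0` on `ℝⁿ`. -/
def IsDiscountedSupersolution {n : ℕ} (δ : ℝ) (f v : EuclideanSpace ℝ (Fin n) → ℝ) : Prop :=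
  LowerSemicontinuous v ∧
    ∀ (y₀ : EuclideanSpace ℝ (Fin n)) (ψ : EuclideanSpace ℝ (Fin n) → ℝ),
      ContDiff ℝ 2 ψ → IsLocalMin (fun y => v y - ψ y) y₀ → 0 ≤ discountedOp δ f (v y₀) ψ y₀

/-- `u` is a (continuous) viscosity solution of `max {δ u - Δu - f, |Du| - 1} = 0` on `ℝⁿ`. -/
def IsDiscountedSolution {n : ℕ} (δ : ℝ) (f u : EuclideanSpace ℝ (Fin n) → ℝ) : Prop :=
  Continuous u ∧ IsDiscountedSubsolution δ f u ∧ IsDiscountedSupersolution δ f u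

/-! ### The Laplacian in coordinates and its sign at a local minimum. -/

section LaplacianCalculus

variable {n : ℕ}

/-! Fix weights `a + b = 1` and maximize the defect `τ u(ax + by) - a u(x) - b u(y)` with `τ < 1`.
The constraint `|Du| ≤ 1` and the growth of `u` make `u` 1-Lipschitz
(`le_add_norm_sub_of_viscosity`), so the factor `τ` makes the defect coercive. It also forces `u` to
lie above a cone of slope `τ < 1` at each of the maximizing points `X`, `Y`. There the gradient
constraint is inactive, and the supersolution property becomes `-Δu ≥ f - δu`. The subsolution
property gives `-Δu ≤ f - δu` everywhere. Translating all points by one vector and comparing at `Z =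
aX + bY`, the defect times `δ` is at most `τ f(Z) - a f(X) - b f(Y)`, which by convexity is at most
`-(1 - τ) f(Z) ≤ (1 - τ) K` when `f ≥ -K`. Then `τ → 1`.

To make this rigorous, `u` is replaced in the supersolution slots by its inf-convolution `v`, for
which the constraint is inactive on a whole ball (`IsInfConvolution.norm_sub_lt`). On small balls
the right-hand sides are frozen to constants. The doubling step
`IsLaplaceSupersolutionOn.sum_nonpos` then needs no theorem on sums: each function is compared with
a polynomial of constant Laplacian having nearly the same boundary values, and the classical minimum
principle applies to the sum of the polynomials. -/

theorem laplacian_eq_sum_fderiv {F : EuclideanSpace ℝ (Fin n) → ℝ} (hF : ContDiff ℝ 2 F)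
    (x : EuclideanSpace ℝ (Fin n)) :
    Δ F x = ∑ i, fderiv ℝ (fun y => fderiv ℝ F y (EuclideanSpace.basisFun (Fin n) ℝ i)) x
      (EuclideanSpace.basisFun (Fin n) ℝ i) := by
  rw [congrFun (InnerProductSpace.laplacian_eq_iteratedFDeriv_orthonormalBasis F
    (EuclideanSpace.basisFun (Fin n) ℝ)) x]
  refine Finset.sum_congr rfl fun i _ => ?_
  have hd : DifferentiableAt ℝ (fderiv ℝ F) x :=
    (hF.fderiv_right (m := 1) (by norm_num)).differentiable (by norm_num) x
  rw [iteratedFDeriv_two_apply, fderiv_clm_apply hd (differentiableAt_const _)]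
  simp

theorem laplacian_comp_add_right (F : EuclideanSpace ℝ (Fin n) → ℝ)
    (a x : EuclideanSpace ℝ (Fin n)) :
    Δ (fun y => F (y + a)) x = Δ F (x + a) := by
  rw [congrFun (InnerProductSpace.laplacian_eq_iteratedFDeriv_orthonormalBasis _
    (EuclideanSpace.basisFun (Fin n) ℝ)) x,
    congrFun (InnerProductSpace.laplacian_eq_iteratedFDeriv_orthonormalBasis F
    (EuclideanSpace.basisFun (Fin n) ℝ)) (x + a)]
  simp [iteratedFDeriv_comp_add_right]

/-- A negative second derivative would make `t` a local maximum as well, hence `g` locally constant.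
Continuity suffices because a nonexistent second derivative has the value zero. -/
theorem deriv_deriv_nonneg_of_isLocalMin {g : ℝ → ℝ} {t : ℝ} (hg : ContinuousAt g t)
    (h : IsLocalMin g t) : 0 ≤ deriv (deriv g) t := by
  by_contra! hneg
  have hmax := isLocalMax_of_deriv_deriv_neg hneg h.deriv_eq_zero hg
  have hconst : g =ᶠ[𝓝 t] fun _ => g t := by
    filter_upwards [h, hmax] with s h₁ h₂ using le_antisymm h₂ h₁
  have : deriv (deriv g) t = 0 := by
    rw [hconst.deriv.deriv_eq]
    simp
  linarith

theorem laplacian_nonneg_of_isLocalMin {F : EuclideanSpace ℝ (Fin n) → ℝ} (hF : ContDiff ℝ 2 F)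
    {x : EuclideanSpace ℝ (Fin n)} (h : IsLocalMin F x) : 0 ≤ Δ F x := by
  rw [laplacian_eq_sum_fderiv hF]
  refine Finset.sum_nonneg fun i _ => ?_
  set e := EuclideanSpace.basisFun (Fin n) ℝ i
  have hline : ∀ t : ℝ, HasDerivAt (fun t : ℝ => x + t • e) e t := fun t => by
    simpa using ((hasDerivAt_id t).smul_const e).const_add x
  have h₁ : deriv (fun t : ℝ => F (x + t • e)) = fun t => fderiv ℝ F (x + t • e) e := by
    funext t
    exact ((hF.differentiable (by norm_num) _).hasFDerivAt.comp_hasDerivAt t (hline t)).deriv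
  have hd : Differentiable ℝ (fun y => fderiv ℝ F y e) :=
    ((hF.fderiv_right (m := 1) (by norm_num)).differentiable (by norm_num)).clm_apply
      (differentiable_const _)
  have h₂ : deriv (deriv (fun t : ℝ => F (x + t • e))) 0 =
      fderiv ℝ (fun y => fderiv ℝ F y e) x e := by
    rw [h₁]
    have := ((hd (x + (0 : ℝ) • e)).hasFDerivAt.comp_hasDerivAt 0 (hline 0)).deriv
    simpa [Function.comp_def] using this
  rw [← h₂]
  have hc : Continuous fun t : ℝ => x + t • e := by fun_prop
  refine deriv_deriv_nonneg_of_isLocalMin (hF.continuous.comp hc).continuousAt ?_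
  have ht : Tendsto (fun t : ℝ => x + t • e) (𝓝 0) (𝓝 x) := by
    simpa using hc.tendsto 0
  simpa [IsLocalMin, IsMinFilter] using ht.eventually h

end LaplacianCalculus

/-! ### Polynomials and their algebraic Laplacian. -/

section PolynomialFunctions

variable {n : ℕ}

/-- The function on Euclidean space defined by a polynomial in the coordinates. -/
noncomputable def polyFun (p : MvPolynomial (Fin n) ℝ) (x : EuclideanSpace ℝ (Fin n)) : ℝ :=
  MvPolynomial.eval (fun i => x i) p

/-- The algebraic Laplacian on polynomials. -/
noncomputable def polyLaplacian (n : ℕ) :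
    MvPolynomial (Fin n) ℝ →ₗ[ℝ] MvPolynomial (Fin n) ℝ :=
  ∑ i, (MvPolynomial.pderiv i : Derivation ℝ _ (MvPolynomial (Fin n) ℝ)).toLinearMap ∘ₗ
    (MvPolynomial.pderiv i : Derivation ℝ _ (MvPolynomial (Fin n) ℝ)).toLinearMap

/-- The polynomial `∑ xᵢ²`. -/
noncomputable def normSqPoly (n : ℕ) : MvPolynomial (Fin n) ℝ := ∑ i, MvPolynomial.X i ^ 2

theorem polyLaplacian_apply (p : MvPolynomial (Fin n) ℝ) :
    polyLaplacian n p = ∑ i, MvPolynomial.pderiv i (MvPolynomial.pderiv i p) := by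
  simp [polyLaplacian]

theorem contDiff_polyFun (p : MvPolynomial (Fin n) ℝ) {k : WithTop ℕ∞} :
    ContDiff ℝ k (polyFun p) := by
  unfold polyFun
  induction p using MvPolynomial.induction_on with
  | C a => simpa using contDiff_const
  | add p q hp hq => simpa using hp.add hq
  | mul_X p i hp =>
    have : ContDiff ℝ k fun x : EuclideanSpace ℝ (Fin n) => x i := by fun_prop
    simpa using hp.mul this

theorem fderiv_polyFun (p : MvPolynomial (Fin n) ℝ) (x : EuclideanSpace ℝ (Fin n)) (i : Fin n) :
    fderiv ℝ (polyFun p) x (EuclideanSpace.basisFun (Fin n) ℝ i) =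
      polyFun (MvPolynomial.pderiv i p) x := by
  induction p using MvPolynomial.induction_on with
  | C a =>
    have h : polyFun (MvPolynomial.C a : MvPolynomial (Fin n) ℝ) = fun _ => a := by
      ext; simp [polyFun]
    rw [h]
    simp [polyFun]
  | add p q hp hq =>
    have h : polyFun (p + q) = polyFun p + polyFun q := by ext; simp [polyFun]
    rw [h, fderiv_add ((contDiff_polyFun p).differentiable one_ne_zero x)
      ((contDiff_polyFun q).differentiable one_ne_zero x)]
    simp only [add_apply, hp, hq]
    simp [polyFun]
  | mul_X p j hp =>
    have h : polyFun (p * MvPolynomial.X j) = fun y => polyFun p y * EuclideanSpace.proj j y := by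
      ext; simp [polyFun]
    rw [h, fderiv_fun_mul ((contDiff_polyFun p).differentiable one_ne_zero x)
      (ContinuousLinearMap.differentiableAt _), ContinuousLinearMap.fderiv]
    simp only [add_apply, smul_apply, hp]
    by_cases hij : i = j
    · subst hij
      simp [polyFun]
    · simp [polyFun, MvPolynomial.pderiv_X_of_ne (Ne.symm hij), Ne.symm hij]

theorem laplacian_polyFun (p : MvPolynomial (Fin n) ℝ) :
    Δ (polyFun p) = polyFun (polyLaplacian n p) := by
  ext x
  rw [laplacian_eq_sum_fderiv (contDiff_polyFun p)]
  simp only [fderiv_polyFun, polyLaplacian_apply]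
  simp [polyFun]

theorem polyFun_normSqPoly (x : EuclideanSpace ℝ (Fin n)) :
    polyFun (normSqPoly n) x = ‖x‖ ^ 2 := by
  simp [polyFun, normSqPoly, EuclideanSpace.norm_sq_eq]

theorem polyLaplacian_normSqPoly : polyLaplacian n (normSqPoly n) = MvPolynomial.C (2 * n : ℝ) := by
  have h (i j : Fin n) : MvPolynomial.pderiv i (MvPolynomial.pderiv i
      (MvPolynomial.X j ^ 2 : MvPolynomial (Fin n) ℝ)) = if i = j then 2 else 0 := by
    by_cases hij : i = j
    · subst hij
      simp [sq, Derivation.leibniz]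
      norm_num
    · simp [sq, Derivation.leibniz, MvPolynomial.pderiv_X_of_ne (Ne.symm hij), hij]
  rw [polyLaplacian_apply]
  simp only [normSqPoly, map_sum, h]
  simp only [Finset.sum_ite_eq, Finset.mem_univ, if_true, Finset.sum_const, Finset.card_univ,
    Fintype.card_fin, nsmul_eq_mul, map_mul, map_natCast, map_ofNat, mul_comm]

theorem totalDegree_pderiv_le {p : MvPolynomial (Fin n) ℝ} {k : ℕ} (hp : p.totalDegree ≤ k + 1)
    (i : Fin n) : (MvPolynomial.pderiv i p).totalDegree ≤ k := by
  refine Finset.sup_le fun s hs => ?_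
  rw [MvPolynomial.mem_support_iff, MvPolynomial.coeff_pderiv] at hs
  have h := MvPolynomial.le_totalDegree
    (MvPolynomial.mem_support_iff.mpr (left_ne_zero_of_mul hs))
  rw [Finsupp.sum_add_index' (by simp) (by simp)] at h
  simp only [Finsupp.sum_single_index] at h
  change s.sum (fun _ e => e) ≤ k
  omega

theorem totalDegree_polyLaplacian_le {p : MvPolynomial (Fin n) ℝ} {k : ℕ}
    (hp : p.totalDegree ≤ k + 2) : (polyLaplacian n p).totalDegree ≤ k := by
  rw [polyLaplacian_apply]
  exact MvPolynomial.totalDegree_finsetSum_le fun i _ =>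
    totalDegree_pderiv_le (totalDegree_pderiv_le hp i) i

end PolynomialFunctions

/-! ### The minimum principle on a ball. -/

section MinimumPrinciple

variable {n : ℕ}

theorem exists_isLocalMin_of_lt_sphere {E : Type*} [NormedAddCommGroup E] [ProperSpace E]
    {w : E → ℝ} {r m : ℝ} (hw : Continuous w)
    (hs : ∀ x ∈ Metric.sphere (0 : E) r, m ≤ w x) {x₀ : E} (hx₀ : x₀ ∈ Metric.ball (0 : E) r)
    (h : w x₀ < m) : ∃ x ∈ Metric.ball (0 : E) r, IsLocalMin w x := by
  obtain ⟨x, hx, hmin⟩ := (isCompact_closedBall (0 : E) r).exists_isMinOn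
    ⟨x₀, Metric.ball_subset_closedBall hx₀⟩ hw.continuousOn
  have hlt : w x < m := (hmin (Metric.ball_subset_closedBall hx₀)).trans_lt h
  have hxb : x ∈ Metric.ball (0 : E) r := by
    rcases (Metric.mem_closedBall.mp hx).lt_or_eq with h' | h'
    · exact h'
    · exact absurd (hs x h') (not_le.mpr hlt)
  exact ⟨x, hxb, hmin.isLocalMin (Filter.mem_of_superset (Metric.isOpen_ball.mem_nhds hxb)
    Metric.ball_subset_closedBall)⟩

theorem contDiff_sub_const_mul_norm_sq {F : EuclideanSpace ℝ (Fin n) → ℝ} (hF : ContDiff ℝ 2 F)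
    (s : ℝ) : ContDiff ℝ 2 (fun x => F x - s * ‖x‖ ^ 2) :=
  hF.sub (contDiff_const.mul (contDiff_norm_sq ℝ))

theorem laplacian_sub_const_mul_norm_sq {F : EuclideanSpace ℝ (Fin n) → ℝ} (hF : ContDiff ℝ 2 F)
    (s : ℝ) (x : EuclideanSpace ℝ (Fin n)) :
    Δ (fun x => F x - s * ‖x‖ ^ 2) x = Δ F x - 2 * n * s := by
  have h : (fun x => F x - s * ‖x‖ ^ 2) = F - s • polyFun (normSqPoly n) := by
    ext x; simp [polyFun_normSqPoly]
  have hq : ContDiff ℝ 2 (polyFun (normSqPoly n)) := contDiff_polyFun _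
  rw [h, ContDiffAt.laplacian_sub hF.contDiffAt
    (f₂ := s • polyFun (normSqPoly n)) (hq.contDiffAt.const_smul s),
    InnerProductSpace.laplacian_smul s hq.contDiffAt, laplacian_polyFun, polyLaplacian_normSqPoly]
  simp [polyFun]
  ring

/-- The weak minimum principle on a ball, in a form strict in the Laplacian. -/
theorem add_le_of_laplacian_le [NeZero n] {F : EuclideanSpace ℝ (Fin n) → ℝ}
    (hF : ContDiff ℝ 2 F) {r m b : ℝ} (hr : 0 < r) (hb : ∀ x, Δ F x ≤ -(2 * n * b))
    (hs : ∀ x ∈ Metric.sphere (0 : EuclideanSpace ℝ (Fin n)) r, m ≤ F x)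
    {x₀ : EuclideanSpace ℝ (Fin n)} (hx₀ : x₀ ∈ Metric.ball 0 r) :
    m + b * (r ^ 2 - ‖x₀‖ ^ 2) ≤ F x₀ := by
  have hn : (0 : ℝ) < n := Nat.cast_pos.mpr (NeZero.pos n)
  have hpos : 0 < r ^ 2 - ‖x₀‖ ^ 2 := by
    have : ‖x₀‖ < r := by simpa using hx₀
    nlinarith [norm_nonneg x₀]
  by_contra! hlt
  -- Half the deficit at `x₀`, divided by `r² - |x₀|²`: adding `(b - ε)|x|²` to `F` leaves `x₀`
  -- below the sphere values but makes the Laplacian at most `-2nε < 0`.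
  set ε := (m + b * (r ^ 2 - ‖x₀‖ ^ 2) - F x₀) / (2 * (r ^ 2 - ‖x₀‖ ^ 2)) with hε
  have hε0 : 0 < ε := div_pos (by linarith) (by linarith)
  have hεm : 2 * (ε * (r ^ 2 - ‖x₀‖ ^ 2)) = m + b * (r ^ 2 - ‖x₀‖ ^ 2) - F x₀ := by
    rw [hε]; field_simp
  obtain ⟨x, -, hmin⟩ := exists_isLocalMin_of_lt_sphere (r := r) (m := m - (ε - b) * r ^ 2)
    (contDiff_sub_const_mul_norm_sq hF (ε - b)).continuous
    (fun x hx => by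
      have : ‖x‖ = r := by simpa using hx
      rw [this]
      linarith [hs x hx]) hx₀ (by nlinarith)
  have := laplacian_nonneg_of_isLocalMin (contDiff_sub_const_mul_norm_sq hF (ε - b)) hmin
  rw [laplacian_sub_const_mul_norm_sq hF] at this
  nlinarith [hb x, mul_pos hn hε0]

end MinimumPrinciple

/-! ### The Dirichlet problem on a ball with polynomial data. -/

section DirichletApproximation

variable {n : ℕ}

theorem polyFun_eq_zero_of_harmonic_of_sphere [NeZero n] {p : MvPolynomial (Fin n) ℝ}
    (hp : polyLaplacian n p = 0) {r : ℝ} (hr : 0 < r)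
    (hs : ∀ x ∈ Metric.sphere (0 : EuclideanSpace ℝ (Fin n)) r, polyFun p x = 0)
    {x : EuclideanSpace ℝ (Fin n)} (hx : x ∈ Metric.ball 0 r) : polyFun p x = 0 := by
  have key (q : MvPolynomial (Fin n) ℝ) (hq : polyLaplacian n q = 0)
      (hqs : ∀ x ∈ Metric.sphere (0 : EuclideanSpace ℝ (Fin n)) r, polyFun q x = 0) :
      0 ≤ polyFun q x := by
    have := add_le_of_laplacian_le (b := 0) (m := 0) (contDiff_polyFun q) hr
      (fun y => by simp [laplacian_polyFun, hq, polyFun]) (fun y hy => (hqs y hy).ge) hx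
    simpa using this
  have hneg (y) : polyFun (-p) y = -polyFun p y := by simp [polyFun]
  have h₁ := key p hp hs
  have h₂ := key (-p) (by simp [hp]) (fun y hy => by rw [hneg, hs y hy, neg_zero])
  rw [hneg] at h₂
  linarith

theorem eq_zero_of_polyFun_eq_zero_on_ball {p : MvPolynomial (Fin n) ℝ} {r : ℝ} (hr : 0 < r)
    (h : ∀ x ∈ Metric.ball (0 : EuclideanSpace ℝ (Fin n)) r, polyFun p x = 0) : p = 0 := by
  have hopen : IsOpen ((fun y : Fin n → ℝ => WithLp.toLp 2 y) ⁻¹'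
      Metric.ball (0 : EuclideanSpace ℝ (Fin n)) r) :=
    Metric.isOpen_ball.preimage (PiLp.continuous_toLp 2 _)
  obtain ⟨δ, hδ, hsub⟩ := Metric.isOpen_iff.mp hopen 0 (by simpa using hr)
  refine MvPolynomial.funext_set (fun _ => Metric.ball (0 : ℝ) δ)
    (fun _ => infinite_of_mem_nhds 0 (Metric.ball_mem_nhds 0 hδ)) fun y hy => ?_
  have hy' : y ∈ Metric.ball (0 : Fin n → ℝ) δ := by
    rw [ball_pi _ hδ]
    exact hy
  simpa [polyFun] using h _ (hsub hy')

theorem normSqPoly_totalDegree_le : (normSqPoly n).totalDegree ≤ 2 :=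
  MvPolynomial.totalDegree_finsetSum_le fun i _ => (MvPolynomial.totalDegree_X_pow i 2).le

/-- Every polynomial can be corrected by a multiple of `r² - |x|²` so as to have a prescribed
Laplacian. -/
theorem exists_polyLaplacian_mul_eq [NeZero n] {r : ℝ} (hr : 0 < r) (p : MvPolynomial (Fin n) ℝ) :
    ∃ q : MvPolynomial (Fin n) ℝ,
      polyLaplacian n ((MvPolynomial.C (r ^ 2) - normSqPoly n) * q) = p := by
  set ρ : MvPolynomial (Fin n) ℝ := MvPolynomial.C (r ^ 2) - normSqPoly n with hρ
  have hρdeg : ρ.totalDegree ≤ 2 :=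
    (MvPolynomial.totalDegree_sub _ _).trans (max_le (by rw [MvPolynomial.totalDegree_C]; exact Nat.zero_le _) normSqPoly_totalDegree_le)
  set k := p.totalDegree
  let V := MvPolynomial.restrictTotalDegree (Fin n) ℝ k
  -- Multiplication by `ρ` raises the degree by at most two and the Laplacian lowers it by two, so
  -- the map acts on a finite-dimensional space, where injectivity gives surjectivity.
  have hmap : ∀ q ∈ V, (polyLaplacian n ∘ₗ LinearMap.mulLeft ℝ ρ) q ∈ V := fun q hq => by
    rw [MvPolynomial.mem_restrictTotalDegree] at hq ⊢
    refine totalDegree_polyLaplacian_le ((MvPolynomial.totalDegree_mul _ _).trans ?_)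
    omega
  let T : V →ₗ[ℝ] V := LinearMap.restrict _ hmap
  -- Uniqueness for the Dirichlet problem: `ρ q` is harmonic and vanishes on the sphere, hence in
  -- the ball, where `ρ` has no zero.
  have hinj : Function.Injective T := by
    rw [← LinearMap.ker_eq_bot, LinearMap.ker_eq_bot']
    rintro ⟨q, hq⟩ hT
    have hT' : polyLaplacian n (ρ * q) = 0 := congrArg Subtype.val hT
    have heval (x : EuclideanSpace ℝ (Fin n)) :
        polyFun (ρ * q) x = (r ^ 2 - ‖x‖ ^ 2) * polyFun q x := by
      rw [← polyFun_normSqPoly]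
      simp [polyFun, hρ]
    have hzero := @polyFun_eq_zero_of_harmonic_of_sphere n _ _ hT' r hr fun x hx => by
      have : ‖x‖ = r := by simpa using hx
      rw [heval, this, sub_self, zero_mul]
    refine Subtype.ext (eq_zero_of_polyFun_eq_zero_on_ball hr fun x hx => ?_)
    have h := hzero hx
    rw [heval] at h
    have hx' : ‖x‖ < r := by simpa using hx
    exact (mul_eq_zero.mp h).resolve_left (by nlinarith [norm_nonneg x])
  obtain ⟨q, hq⟩ := LinearMap.injective_iff_surjective.mp hinj
    ⟨p, (MvPolynomial.mem_restrictTotalDegree _ _ _).mpr le_rfl⟩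
  exact ⟨q, congrArg Subtype.val hq⟩

/-- Stone–Weierstrass for the algebra generated by the coordinates. -/
theorem exists_polyFun_near {g : EuclideanSpace ℝ (Fin n) → ℝ} (hg : Continuous g)
    {K : Set (EuclideanSpace ℝ (Fin n))} (hK : IsCompact K) {η : ℝ} (hη : 0 < η) :
    ∃ p : MvPolynomial (Fin n) ℝ, ∀ x ∈ K, |polyFun p x - g x| < η := by
  let c (i : Fin n) : C(EuclideanSpace ℝ (Fin n), ℝ) := ⟨fun x => x i, by fun_prop⟩
  have hsep : (MvPolynomial.aeval (R := ℝ) c).range.SeparatesPoints := fun x y hxy => by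
    obtain ⟨i, hi⟩ : ∃ i, x i ≠ y i := by
      by_contra! h
      exact hxy (PiLp.ext h)
    exact ⟨c i, ⟨c i, ⟨MvPolynomial.X i, by simp⟩, rfl⟩, hi⟩
  obtain ⟨_, ⟨p, rfl⟩, hp⟩ :=
    ContinuousMap.exists_mem_subalgebra_near_continuous_of_isCompact_of_separatesPoints
      hsep ⟨g, hg⟩ hK hη
  have heval (x : EuclideanSpace ℝ (Fin n)) : MvPolynomial.aeval c p x = polyFun p x := by
    clear hp
    unfold polyFun
    induction p using MvPolynomial.induction_on with
    | C a => simp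
    | add p q hp hq => simp [hp, hq]
    | mul_X p i hp => simp [hp, c]
  refine ⟨p, fun x hx => ?_⟩
  simpa [heval] using hp x hx

/-- Approximate solvability of the Dirichlet problem on a ball for a constant right-hand side. -/
theorem exists_laplacian_eq_near_sphere [NeZero n] {g : EuclideanSpace ℝ (Fin n) → ℝ}
    (hg : Continuous g) {r η : ℝ} (hr : 0 < r) (hη : 0 < η) (c : ℝ) :
    ∃ h : EuclideanSpace ℝ (Fin n) → ℝ, ContDiff ℝ 2 h ∧ (∀ x, Δ h x = c) ∧
      ∀ x ∈ Metric.sphere (0 : EuclideanSpace ℝ (Fin n)) r, |h x - g x| < η := by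
  obtain ⟨p, hp⟩ := exists_polyFun_near hg (isCompact_sphere 0 r) hη
  obtain ⟨q, hq⟩ := exists_polyLaplacian_mul_eq hr (polyLaplacian n p - MvPolynomial.C c)
  -- The correction vanishes on the sphere, so the boundary approximation survives.
  refine ⟨polyFun (p - (MvPolynomial.C (r ^ 2) - normSqPoly n) * q), contDiff_polyFun _,
    fun x => ?_, fun x hx => ?_⟩
  · rw [laplacian_polyFun, map_sub, hq]
    simp [polyFun]
  · have hxr : ‖x‖ = r := by simpa using hx
    have : polyFun (p - (MvPolynomial.C (r ^ 2) - normSqPoly n) * q) x =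
        polyFun p x - (r ^ 2 - ‖x‖ ^ 2) * polyFun q x := by
      rw [← polyFun_normSqPoly]
      simp [polyFun]
    rw [this, hxr, sub_self, zero_mul, sub_zero]
    exact hp x hx

end DirichletApproximation

/-! ### Viscosity supersolutions of the Poisson inequality and their sums. -/

section LaplaceSupersolution

variable {n : ℕ}

/-- `w` satisfies `-Δw ≥ b` on `s` in the viscosity sense. -/
def IsLaplaceSupersolutionOn (w : EuclideanSpace ℝ (Fin n) → ℝ)
    (s : Set (EuclideanSpace ℝ (Fin n))) (b : ℝ) : Prop :=
  ∀ x ∈ s, ∀ ψ : EuclideanSpace ℝ (Fin n) → ℝ,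
    ContDiff ℝ 2 ψ → IsLocalMin (fun y => w y - ψ y) x → b ≤ -Δ ψ x

theorem IsLaplaceSupersolutionOn.mono {w : EuclideanSpace ℝ (Fin n) → ℝ}
    {s t : Set (EuclideanSpace ℝ (Fin n))} {b : ℝ} (h : IsLaplaceSupersolutionOn w s b)
    (hts : t ⊆ s) : IsLaplaceSupersolutionOn w t b :=
  fun x hx => h x (hts hx)

theorem IsLaplaceSupersolutionOn.comp_add_right {w : EuclideanSpace ℝ (Fin n) → ℝ}
    {a : EuclideanSpace ℝ (Fin n)} {r b : ℝ}
    (h : IsLaplaceSupersolutionOn w (Metric.ball a r) b) :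
    IsLaplaceSupersolutionOn (fun x => w (x + a)) (Metric.ball 0 r) b := by
  intro x hx ψ hψ hmin
  have hx' : x + a ∈ Metric.ball a r := by simpa [dist_eq_norm] using hx
  have := h (x + a) hx' (fun y => ψ (y + -a)) (hψ.comp (contDiff_id.add contDiff_const)) <| by
    have ht : Tendsto (fun y => y + -a) (𝓝 (x + a)) (𝓝 x) := by
      have : Continuous fun y : EuclideanSpace ℝ (Fin n) => y + -a := by fun_prop
      simpa using this.tendsto (x + a)
    simpa [IsLocalMin, IsMinFilter] using ht.eventually hmin
  rw [laplacian_comp_add_right] at this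
  simpa using this

theorem laplacian_const_mul {ψ : EuclideanSpace ℝ (Fin n) → ℝ} (hψ : ContDiff ℝ 2 ψ) (c : ℝ)
    (x : EuclideanSpace ℝ (Fin n)) : Δ (fun y => c * ψ y) x = c * Δ ψ x :=
  InnerProductSpace.laplacian_smul c hψ.contDiffAt

theorem IsLaplaceSupersolutionOn.const_mul {w : EuclideanSpace ℝ (Fin n) → ℝ}
    {s : Set (EuclideanSpace ℝ (Fin n))} {b c : ℝ} (hc : 0 < c)
    (h : IsLaplaceSupersolutionOn w s b) :
    IsLaplaceSupersolutionOn (fun x => c * w x) s (c * b) := by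
  intro x hx ψ hψ hmin
  have := h x hx (fun y => c⁻¹ * ψ y) (contDiff_const.mul hψ) <| by
    filter_upwards [hmin] with y hy
    have := mul_le_mul_of_nonneg_left hy (inv_pos.mpr hc).le
    simpa [mul_sub, hc.ne'] using this
  rw [laplacian_const_mul hψ] at this
  calc c * b ≤ c * -(c⁻¹ * Δ ψ x) := mul_le_mul_of_nonneg_left this hc.le
    _ = -Δ ψ x := by field_simp

/-- The smooth `h` is itself an admissible test function at an interior minimum of `w - h`. -/
theorem IsLaplaceSupersolutionOn.le_of_sphere {w h : EuclideanSpace ℝ (Fin n) → ℝ} {r b : ℝ}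
    (hw : Continuous w) (hsup : IsLaplaceSupersolutionOn w (Metric.ball 0 r) b)
    (hh : ContDiff ℝ 2 h) (hlap : ∀ x, -Δ h x < b)
    (hs : ∀ x ∈ Metric.sphere (0 : EuclideanSpace ℝ (Fin n)) r, h x ≤ w x)
    {x : EuclideanSpace ℝ (Fin n)} (hx : x ∈ Metric.ball 0 r) : h x ≤ w x := by
  by_contra! hlt
  obtain ⟨y, hy, hmin⟩ := exists_isLocalMin_of_lt_sphere (m := 0) (hw.sub hh.continuous)
    (fun z hz => sub_nonneg.mpr (hs z hz)) hx (sub_neg.mpr hlt)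
  exact absurd (hsup y hy h hh hmin) (not_le.mpr (hlap y))

/-- If a finite sum of viscosity supersolutions of `-Δwᵢ ≥ bᵢ` has a local minimum, then the sum of
the constants `bᵢ` is nonpositive. -/
theorem IsLaplaceSupersolutionOn.sum_nonpos [NeZero n] {ι : Type*} [Fintype ι]
    {w : ι → EuclideanSpace ℝ (Fin n) → ℝ} {b : ι → ℝ} {r : ℝ} (hr : 0 < r)
    (hw : ∀ i, Continuous (w i))
    (hsup : ∀ i, IsLaplaceSupersolutionOn (w i) (Metric.ball 0 r) (b i))
    (hmin : IsLocalMin (fun x => ∑ i, w i x) 0) : ∑ i, b i ≤ 0 := by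
  by_contra! hB
  have hn : (0 : ℝ) < n := Nat.cast_pos.mpr (NeZero.pos n)
  have hN : (0 : ℝ) < Fintype.card ι := by
    rcases isEmpty_or_nonempty ι with h | h
    · simp at hB
    · exact Nat.cast_pos.mpr Fintype.card_pos
  obtain ⟨r₁, hr₁, hsub⟩ := Metric.nhds_basis_closedBall.mem_iff.mp hmin
  set R := min r r₁
  have hR : 0 < R := lt_min hr hr₁
  set B := ∑ i, b i
  set N : ℝ := ((Fintype.card ι : ℕ) : ℝ)
  -- The comparison functions satisfy `Δhᵢ = -bᵢ + B/(2N)`, so their sum has Laplacian `-B/2 = -2nβ`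
  -- and gains `βR²` at the center. On the sphere `wᵢ - 2η < hᵢ < wᵢ`, and `η` makes the total loss
  -- `2Nη` only half that gain. The sum of the `hᵢ` at the center then exceeds that of the `wᵢ`,
  -- against `hᵢ 0 ≤ wᵢ 0`.
  set β := B / (4 * n) with hβ
  have hβ0 : 0 < β := by positivity
  set η := β * R ^ 2 / (4 * N) with hη
  have hη0 : 0 < η := by positivity
  choose h hC hlap hnear using fun i =>
    exists_laplacian_eq_near_sphere ((hw i).sub continuous_const) hR hη0 (c := -b i + B / (2 * N))
      (g := fun x => w i x - η)
  have h0 : (0 : EuclideanSpace ℝ (Fin n)) ∈ Metric.ball 0 R := by simpa using hR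
  have hle (i : ι) : h i 0 ≤ w i 0 := by
    refine IsLaplaceSupersolutionOn.le_of_sphere (hw i)
      ((hsup i).mono (Metric.ball_subset_ball (min_le_left _ _))) (hC i) (fun x => ?_)
      (fun x hx => ?_) h0
    · have : 0 < B / (2 * N) := by positivity
      rw [hlap]
      linarith
    · have := (abs_lt.mp (hnear i x hx)).2
      linarith
  have hsumC : ContDiff ℝ 2 fun x => ∑ i, h i x := ContDiff.sum fun i _ => hC i
  have hsumlap (x) : Δ (fun x => ∑ i, h i x) x = -(2 * n * β) := by
    have : Δ (fun x => ∑ i, h i x) x = ∑ i, Δ (h i) x := by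
      classical
      have key (s : Finset ι) : Δ (fun x => ∑ i ∈ s, h i x) x = ∑ i ∈ s, Δ (h i) x := by
        induction s using Finset.induction_on with
        | empty => simp
        | insert i s hi ih =>
          have hs : ContDiff ℝ 2 fun x => ∑ i ∈ s, h i x := ContDiff.sum fun i _ => hC i
          simp only [Finset.sum_insert hi, ← ih]
          exact (hC i).contDiffAt.laplacian_add hs.contDiffAt
      exact key _
    rw [this]
    simp only [hlap, Finset.sum_add_distrib, Finset.sum_neg_distrib, Finset.sum_const,
      Finset.card_univ, nsmul_eq_mul]
    change -B + N * (B / (2 * N)) = _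
    rw [hβ]
    field_simp
    ring
  have hmp := add_le_of_laplacian_le (m := (∑ i, w i 0) - N * (2 * η)) hsumC hR
    (fun x => (hsumlap x).le) (fun x hx => ?_) h0
  · have h₁ : ∑ i, h i 0 ≤ ∑ i, w i 0 := Finset.sum_le_sum fun i _ => hle i
    have h₂ : N * (2 * η) = β * R ^ 2 / 2 := by rw [hη]; field_simp; ring
    have h₃ : 0 < β * R ^ 2 := by positivity
    simp only [norm_zero] at hmp
    linarith
  · have hx' : x ∈ Metric.closedBall (0 : EuclideanSpace ℝ (Fin n)) r₁ :=
      Metric.closedBall_subset_closedBall (min_le_right _ _) (Metric.sphere_subset_closedBall hx)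
    have h₁ : ∑ i, w i 0 ≤ ∑ i, w i x := hsub hx'
    have h₂ : ∑ i, (w i x - 2 * η) ≤ ∑ i, h i x := Finset.sum_le_sum fun i _ => by
      have := (abs_lt.mp (hnear i x hx)).1
      linarith
    rw [Finset.sum_sub_distrib, Finset.sum_const, Finset.card_univ, nsmul_eq_mul] at h₂
    linarith

end LaplaceSupersolution

/-! ### The Lipschitz bound from the gradient constraint. -/

section LipschitzBound

variable {n : ℕ}

theorem norm_gradient_eq (φ : EuclideanSpace ℝ (Fin n) → ℝ) (x : EuclideanSpace ℝ (Fin n)) :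
    ‖∇ φ x‖ = ‖fderiv ℝ φ x‖ := by
  simp [gradient]

theorem exists_le_mul_norm_add {E : Type*} [NormedAddCommGroup E] {u : E → ℝ} (hu : Continuous u)
    {L a : ℝ} (hgrowth : Tendsto (fun x => u x / ‖x‖) (cocompact E) (𝓝 L)) (ha : L < a) :
    ∃ C, ∀ x, u x ≤ a * ‖x‖ + C := by
  obtain ⟨K, hK, hsub⟩ := mem_cocompact.mp (hgrowth.eventually_lt_const ha)
  obtain ⟨C, hC⟩ := hK.bddAbove_image
    (hu.sub (continuous_const.mul continuous_norm : Continuous fun x : E => a * ‖x‖)).continuousOn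
  refine ⟨max C (max 0 (u 0)), fun x => ?_⟩
  by_cases hx : x ∈ K
  · have : u x - a * ‖x‖ ≤ C := hC (Set.mem_image_of_mem _ hx)
    linarith [le_max_left C (max 0 (u 0))]
  · rcases eq_or_ne x 0 with rfl | h0
    · simp
    · have h₁ : u x / ‖x‖ < a := hsub hx
      rw [div_lt_iff₀ (norm_pos_iff.mpr h0)] at h₁
      linarith [(le_max_left 0 (u 0)).trans (le_max_right C (max 0 (u 0)))]

theorem exists_mul_norm_sub_le {E : Type*} [NormedAddCommGroup E] {u : E → ℝ} (hu : Continuous u)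
    {L a : ℝ} (hgrowth : Tendsto (fun x => u x / ‖x‖) (cocompact E) (𝓝 L)) (ha : a < L) :
    ∃ C, ∀ x, a * ‖x‖ - C ≤ u x := by
  obtain ⟨C, hC⟩ := exists_le_mul_norm_add (a := -a) (L := -L) hu.neg
    (by simpa [neg_div] using hgrowth.neg) (by linarith)
  refine ⟨C, fun x => ?_⟩
  have : -u x ≤ -a * ‖x‖ + C := hC x
  linarith

/-- The smoothed cone `√(η² + |x - x₀|²)`. -/
noncomputable def smoothCone {n : ℕ} (η : ℝ) (x₀ x : EuclideanSpace ℝ (Fin n)) : ℝ :=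
  √(η ^ 2 + ‖x - x₀‖ ^ 2)

theorem contDiff_smoothCone {η : ℝ} (hη : 0 < η) (x₀ : EuclideanSpace ℝ (Fin n))
    {k : WithTop ℕ∞} : ContDiff ℝ k (smoothCone η x₀) :=
  (contDiff_const.add ((contDiff_id.sub contDiff_const).norm_sq ℝ)).sqrt fun x => by positivity

theorem fderiv_smoothCone {η : ℝ} (hη : 0 < η) (x₀ x : EuclideanSpace ℝ (Fin n)) :
    fderiv ℝ (smoothCone η x₀) x (x - x₀) = ‖x - x₀‖ ^ 2 / smoothCone η x₀ x := by
  have h₁ : HasFDerivAt (fun y : EuclideanSpace ℝ (Fin n) => η ^ 2 + ‖y - x₀‖ ^ 2) _ x :=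
    (((hasFDerivAt_id x).sub_const x₀).norm_sq).const_add (η ^ 2)
  have h₂ := h₁.sqrt (by positivity)
  have h₃ : fderiv ℝ (smoothCone η x₀) x = _ := h₂.fderiv
  rw [h₃]
  simp only [smoothCone, id, ContinuousLinearMap.comp_id, smul_apply, innerSL_apply_apply,
    real_inner_self_eq_norm_sq, smul_eq_mul, nsmul_eq_mul]
  push_cast
  field_simp

theorem le_smoothCone (η : ℝ) (x₀ x : EuclideanSpace ℝ (Fin n)) :
    ‖x - x₀‖ ≤ smoothCone η x₀ x :=
  Real.le_sqrt_of_sq_le (by nlinarith [sq_nonneg η])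

theorem smoothCone_le {η : ℝ} (hη : 0 ≤ η) (x₀ x : EuclideanSpace ℝ (Fin n)) :
    smoothCone η x₀ x ≤ η + ‖x - x₀‖ :=
  Real.sqrt_le_iff.mpr ⟨by positivity, by nlinarith [mul_nonneg hη (norm_nonneg (x - x₀))]⟩

theorem smoothCone_sq (η : ℝ) (x₀ x : EuclideanSpace ℝ (Fin n)) :
    smoothCone η x₀ x ^ 2 = η ^ 2 + ‖x - x₀‖ ^ 2 :=
  Real.sq_sqrt (by positivity)

/-- Testing the derivative in the radial direction gives `L²d² ≤ η² + d²` for `d = ‖x - x₀‖`, and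
`(L - 1)² ≤ L² - 1`. A steep smoothed cone thus obeys the gradient bound only near its vertex. -/
theorem mul_norm_sub_le_of_norm_fderiv_le {η L : ℝ} (hη : 0 < η) (hL : 1 < L)
    {x₀ x : EuclideanSpace ℝ (Fin n)}
    (h : ‖fderiv ℝ (fun y => L * smoothCone η x₀ y) x‖ ≤ 1) : (L - 1) * ‖x - x₀‖ ≤ η := by
  have hpos : 0 < smoothCone η x₀ x := Real.sqrt_pos.mpr (by positivity)
  have hd : fderiv ℝ (fun y => L * smoothCone η x₀ y) x (x - x₀) =
      L * (‖x - x₀‖ ^ 2 / smoothCone η x₀ x) := by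
    rw [fderiv_const_mul ((contDiff_smoothCone hη x₀).differentiable one_ne_zero x)]
    simp [fderiv_smoothCone hη]
  have h₁ := (le_abs_self _).trans
    ((fderiv ℝ (fun y => L * smoothCone η x₀ y) x).le_of_opNorm_le h (x - x₀))
  rw [hd, one_mul] at h₁
  by_contra! hlt
  have hx : 0 < ‖x - x₀‖ := by
    by_contra! h0
    nlinarith
  rw [mul_div_assoc', div_le_iff₀ hpos] at h₁
  have h₂ : L * ‖x - x₀‖ ≤ smoothCone η x₀ x := by nlinarith
  have h₃ := smoothCone_sq η x₀ x
  have h₄ : (L * ‖x - x₀‖) ^ 2 ≤ η ^ 2 + ‖x - x₀‖ ^ 2 := by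
    rw [← h₃]
    exact pow_le_pow_left₀ (by positivity) h₂ 2
  have h₅ : η ^ 2 < ((L - 1) * ‖x - x₀‖) ^ 2 := pow_lt_pow_left₀ hlt hη.le two_ne_zero
  nlinarith [mul_pos (sub_pos.mpr hL) (pow_pos hx 2)]

/-- A continuous function with `|Du| ≤ 1` in the viscosity sense and growth rate one at infinity
is `1`-Lipschitz. -/
theorem le_add_norm_sub_of_viscosity {u : EuclideanSpace ℝ (Fin n) → ℝ} (hu : Continuous u)
    (hgrowth : Tendsto (fun x => u x / ‖x‖) (cocompact (EuclideanSpace ℝ (Fin n))) (𝓝 1))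
    (hgrad : ∀ (x : EuclideanSpace ℝ (Fin n)) (φ : EuclideanSpace ℝ (Fin n) → ℝ),
      ContDiff ℝ 2 φ → IsLocalMax (fun y => u y - φ y) x → ‖fderiv ℝ φ x‖ ≤ 1)
    (x x₀ : EuclideanSpace ℝ (Fin n)) : u x ≤ u x₀ + ‖x - x₀‖ := by
  have key (L : ℝ) (hL : 1 < L) : u x ≤ u x₀ + L * ‖x - x₀‖ := by
    refine le_of_forall_pos_le_add fun ε hε => ?_
    obtain ⟨θ, hθ, hcont⟩ := Metric.continuous_iff.mp hu x₀ (ε / 2) (by positivity)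
    -- The first entry bounds the smoothing error `Lη` by `ε/2`; the second puts the maximum point
    -- `z` within `θ` of `x₀`, where `u` varies by less than `ε/2`.
    set η := min (ε / (2 * L)) (θ * (L - 1) / 2) with hη
    have hη0 : 0 < η := lt_min (by positivity) (by nlinarith)
    have hη₁ : L * η ≤ ε / 2 := by
      calc L * η ≤ L * (ε / (2 * L)) := by gcongr; exact min_le_left _ _
        _ = ε / 2 := by field_simp
    have hC2 : ContDiff ℝ 2 fun y => L * smoothCone η x₀ y :=
      contDiff_const.mul (contDiff_smoothCone hη0 x₀)
    -- A slope strictly between the growth rate `1` and the cone slope `L` makes the maximum exist.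
    obtain ⟨C, hC⟩ := exists_le_mul_norm_add hu hgrowth (a := (1 + L) / 2) (by linarith)
    have hev : ∀ᶠ y in cocompact (EuclideanSpace ℝ (Fin n)),
        u y - L * smoothCone η x₀ y ≤ u x₀ - L * smoothCone η x₀ x₀ := by
      filter_upwards [(tendsto_norm_cocompact_atTop
        (E := EuclideanSpace ℝ (Fin n))).eventually_ge_atTop
        ((C + L * ‖x₀‖ - (u x₀ - L * smoothCone η x₀ x₀)) / ((L - 1) / 2))] with y hy
      rw [div_le_iff₀ (by linarith)] at hy
      have h₁ := le_smoothCone η x₀ y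
      have h₂ : ‖y‖ - ‖x₀‖ ≤ ‖y - x₀‖ := norm_sub_norm_le _ _
      have h₃ : L * (‖y‖ - ‖x₀‖) ≤ L * smoothCone η x₀ y :=
        mul_le_mul_of_nonneg_left (h₂.trans h₁) (by linarith)
      linarith [hC y]
    obtain ⟨z, hz⟩ := (hu.sub hC2.continuous).exists_forall_ge' x₀ hev
    have hz' := mul_norm_sub_le_of_norm_fderiv_le hη0 hL
      (hgrad z _ hC2 (Filter.Eventually.of_forall hz))
    have hzθ : ‖z - x₀‖ < θ := by
      have : (L - 1) * ‖z - x₀‖ < (L - 1) * θ := by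
        have := min_le_right (ε / (2 * L)) (θ * (L - 1) / 2)
        nlinarith
      exact lt_of_mul_lt_mul_left this (by linarith)
    have h₁ : u z - u x₀ < ε / 2 :=
      (le_abs_self _).trans_lt (by simpa [Real.dist_eq] using hcont z (by rwa [dist_eq_norm]))
    have h₂ : u x - L * smoothCone η x₀ x ≤ u z - L * smoothCone η x₀ z := hz x
    have h₃ : L * smoothCone η x₀ x ≤ L * (η + ‖x - x₀‖) :=
      mul_le_mul_of_nonneg_left (smoothCone_le hη0.le x₀ x) (by linarith)
    have h₄ : 0 ≤ L * smoothCone η x₀ z := mul_nonneg (by linarith) (Real.sqrt_nonneg _)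
    linarith
  refine le_of_forall_pos_le_add fun ε hε => ?_
  have hd : 0 < 1 + ‖x - x₀‖ := by positivity
  have := key (1 + ε / (1 + ‖x - x₀‖)) (by linarith [div_pos hε hd])
  have h₁ : ε / (1 + ‖x - x₀‖) * ‖x - x₀‖ ≤ ε := by
    rw [div_mul_eq_mul_div, div_le_iff₀ hd]
    nlinarith
  linarith

theorem IsDiscountedSubsolution.le_add_norm_sub {δ : ℝ} {f u : EuclideanSpace ℝ (Fin n) → ℝ}
    (hu : Continuous u) (hsub : IsDiscountedSubsolution δ f u)
    (hgrowth : Tendsto (fun x => u x / ‖x‖) (cocompact (EuclideanSpace ℝ (Fin n))) (𝓝 1))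
    (x y : EuclideanSpace ℝ (Fin n)) : u x ≤ u y + ‖x - y‖ := by
  refine le_add_norm_sub_of_viscosity hu hgrowth (fun z φ hφ hmax => ?_) x y
  have := (le_max_right _ _).trans (hsub.2 z φ hφ hmax)
  rw [norm_gradient_eq] at this
  linarith

end LipschitzBound

/-! ### Inf-convolution and the inactive gradient constraint. -/

section InfConvolution

variable {n : ℕ}

/-- `v` is the inf-convolution of `u` with `|·|² / (2ε)`, and the infimum is attained. -/
structure IsInfConvolution (ε : ℝ) (u v : EuclideanSpace ℝ (Fin n) → ℝ) : Prop where
  le : ∀ x y, v x ≤ u y + ‖x - y‖ ^ 2 / (2 * ε)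
  exists_eq : ∀ x, ∃ y, v x = u y + ‖x - y‖ ^ 2 / (2 * ε)

theorem exists_isInfConvolution {u : EuclideanSpace ℝ (Fin n) → ℝ} (hu : Continuous u)
    (hlip : ∀ x y, u x ≤ u y + ‖x - y‖) {ε : ℝ} (hε : 0 < ε) :
    ∃ v, IsInfConvolution ε u v := by
  have hmin (x : EuclideanSpace ℝ (Fin n)) :
      ∃ y, ∀ z, u y + ‖x - y‖ ^ 2 / (2 * ε) ≤ u z + ‖x - z‖ ^ 2 / (2 * ε) := by
    have hc : Continuous fun z => u z + ‖x - z‖ ^ 2 / (2 * ε) := by fun_prop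
    refine hc.exists_forall_le' x ?_
    filter_upwards [(tendsto_norm_cocompact_atTop
      (E := EuclideanSpace ℝ (Fin n))).eventually_ge_atTop (‖x‖ + 2 * ε)] with z hz
    have h₁ : 2 * ε ≤ ‖x - z‖ := by
      have := norm_sub_norm_le z x
      rw [norm_sub_rev] at this
      linarith
    have h₂ : ‖x - z‖ ≤ ‖x - z‖ ^ 2 / (2 * ε) := by
      rw [le_div_iff₀ (by positivity)]
      nlinarith [norm_nonneg (x - z)]
    have := hlip x z
    simp only [sub_self, norm_zero]
    norm_num
    linarith
  choose y hy using hmin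
  exact ⟨fun x => u (y x) + ‖x - y x‖ ^ 2 / (2 * ε), fun x z => hy x z, fun x => ⟨y x, rfl⟩⟩

namespace IsInfConvolution

variable {ε : ℝ} {u v : EuclideanSpace ℝ (Fin n) → ℝ}

theorem le_self (h : IsInfConvolution ε u v) (x : EuclideanSpace ℝ (Fin n)) : v x ≤ u x := by
  simpa using h.le x x

theorem self_sub_le (h : IsInfConvolution ε u v) (hε : 0 < ε)
    (hlip : ∀ x y, u x ≤ u y + ‖x - y‖) (x : EuclideanSpace ℝ (Fin n)) : u x - ε / 2 ≤ v x := by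
  obtain ⟨y, hy⟩ := h.exists_eq x
  have h₁ : ‖x - y‖ - ε / 2 ≤ ‖x - y‖ ^ 2 / (2 * ε) := by
    rw [le_div_iff₀ (by positivity)]
    nlinarith [sq_nonneg (‖x - y‖ - ε)]
  linarith [hlip x y]

/-- Shift the minimizer for `y` along with the point, keeping the proximal step and hence the
penalty unchanged. -/
theorem le_add_norm_sub (h : IsInfConvolution ε u v)
    (hlip : ∀ x y, u x ≤ u y + ‖x - y‖) (x y : EuclideanSpace ℝ (Fin n)) :
    v x ≤ v y + ‖x - y‖ := by
  obtain ⟨z, hz⟩ := h.exists_eq y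
  have h₁ := h.le x (x - (y - z))
  have h₂ := hlip (x - (y - z)) z
  have e₁ : x - (x - (y - z)) = y - z := by abel
  have e₂ : x - (y - z) - z = x - y := by abel
  rw [e₁] at h₁
  rw [e₂] at h₂
  linarith

theorem continuous (h : IsInfConvolution ε u v) (hlip : ∀ x y, u x ≤ u y + ‖x - y‖) :
    Continuous v :=
  (LipschitzWith.of_le_add fun x y => by
    rw [dist_eq_norm]
    exact h.le_add_norm_sub hlip x y).continuous

theorem norm_sub_le (h : IsInfConvolution ε u v) (hε : 0 < ε)
    (hlip : ∀ x y, u x ≤ u y + ‖x - y‖) {x y : EuclideanSpace ℝ (Fin n)}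
    (hy : v x = u y + ‖x - y‖ ^ 2 / (2 * ε)) : ‖x - y‖ ≤ 2 * ε := by
  by_contra! hlt
  have h₁ : ‖x - y‖ < ‖x - y‖ ^ 2 / (2 * ε) := by
    rw [lt_div_iff₀ (by positivity)]
    nlinarith
  linarith [h.le_self x, hlip x y]

/-- The paraboloid centered at `y` touches `v` from above at `x` while `ψ`, up to a constant,
touches it from below, so their derivatives at `x` agree. The length of the proximal step thus
decides whether the gradient constraint is active. -/
theorem norm_fderiv_eq (h : IsInfConvolution ε u v) (hε : 0 < ε)
    {x y : EuclideanSpace ℝ (Fin n)} (hy : v x = u y + ‖x - y‖ ^ 2 / (2 * ε))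
    {ψ : EuclideanSpace ℝ (Fin n) → ℝ} (hψ : ContDiff ℝ 2 ψ)
    (hmin : IsLocalMin (fun z => v z - ψ z) x) : ‖fderiv ℝ ψ x‖ = ‖x - y‖ / ε := by
  have hq : HasFDerivAt (fun z => (2 * ε)⁻¹ * ‖z - y‖ ^ 2) (ε⁻¹ • innerSL ℝ (x - y)) x := by
    have := (((hasFDerivAt_id x).sub_const y).norm_sq).const_mul ((2 * ε)⁻¹)
    convert! this using 1
    ext w
    simp
    field_simp
  have hmin' : IsLocalMin (fun z => (2 * ε)⁻¹ * ‖z - y‖ ^ 2 - ψ z) x := by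
    filter_upwards [hmin] with z hz
    have := h.le z y
    rw [div_eq_inv_mul] at this hy
    linarith
  have h0 := hmin'.hasFDerivAt_eq_zero
    (hq.sub (hψ.differentiable two_ne_zero x).hasFDerivAt)
  rw [← sub_eq_zero.mp h0, norm_smul, innerSL_apply_norm, Real.norm_of_nonneg (by positivity)]
  field_simp

/-- With the displacement `x - y` held fixed the penalty is constant, so a test function for `v` at
`x` translates to one for `u` at `y`. -/
theorem isLocalMin_translate (h : IsInfConvolution ε u v)
    {x y : EuclideanSpace ℝ (Fin n)} (hy : v x = u y + ‖x - y‖ ^ 2 / (2 * ε))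
    {ψ : EuclideanSpace ℝ (Fin n) → ℝ} (hmin : IsLocalMin (fun z => v z - ψ z) x) :
    IsLocalMin (fun z => u z - ψ (z + (x - y))) y := by
  have ht : Tendsto (fun z => z + (x - y)) (𝓝 y) (𝓝 x) := by
    have : Continuous fun z : EuclideanSpace ℝ (Fin n) => z + (x - y) := by fun_prop
    simpa using this.tendsto y
  filter_upwards [ht.eventually hmin] with z hz
  have h₁ := h.le (z + (x - y)) z
  have e₁ : z + (x - y) - z = x - y := by abel
  have e₂ : y + (x - y) = x := by abel
  rw [e₁] at h₁
  rw [e₂]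
  linarith

/-- At points where the proximal step is shorter than `ε`, the inf-convolution of a supersolution
satisfies the unconstrained inequality. -/
theorem sub_le_neg_laplacian (h : IsInfConvolution ε u v) (hε : 0 < ε) {δ : ℝ}
    {f : EuclideanSpace ℝ (Fin n) → ℝ} (hsup : IsDiscountedSupersolution δ f u)
    {x y : EuclideanSpace ℝ (Fin n)} (hy : v x = u y + ‖x - y‖ ^ 2 / (2 * ε))
    (hlt : ‖x - y‖ < ε) {ψ : EuclideanSpace ℝ (Fin n) → ℝ} (hψ : ContDiff ℝ 2 ψ)
    (hmin : IsLocalMin (fun z => v z - ψ z) x) : f y - δ * u y ≤ -Δ ψ x := by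
  have hop := hsup.2 y (fun z => ψ (z + (x - y))) (hψ.comp (contDiff_id.add contDiff_const))
    (h.isLocalMin_translate hy hmin)
  have e : y + (x - y) = x := by abel
  rw [discountedOp, laplacian_comp_add_right, norm_gradient_eq, fderiv_comp_add_right, e,
    h.norm_fderiv_eq hε hy hψ hmin] at hop
  have : ‖x - y‖ / ε < 1 := (div_lt_one hε).mpr hlt
  rcases le_max_iff.mp hop with h' | h'
  · linarith
  · linarith

/-- Near a point where the inf-convolution is bounded below by a cone of slope `τ < 1`, the
proximal steps are shorter than `ε`. -/
theorem norm_sub_lt (h : IsInfConvolution ε u v) (hε : 0 < ε)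
    (hlip : ∀ x y, u x ≤ u y + ‖x - y‖) {τ r : ℝ} (hτ : 0 < τ) (hτ₁ : τ < 1)
    (hr : r ≤ ε * (1 - τ) ^ 2 / 4) {X x y : EuclideanSpace ℝ (Fin n)}
    (hX : ∀ z, v X - τ * ‖z - X‖ ≤ v z) (hx : ‖x - X‖ < r)
    (hy : v x = u y + ‖x - y‖ ^ 2 / (2 * ε)) : ‖x - y‖ < ε := by
  by_contra! hge
  -- Moving from `x` the fraction `t` towards `y` lowers `v` by at least `(2t - t²)D/2` when `D ≥
  -- ε`, whereas the cone at `X` and the Lipschitz bound allow less than `2r + τtD`. With `τ = 1 -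
  -- t` this leaves `t²D/2 < 2r`, contrary to the choice of `r`.
  set t := 1 - τ with ht
  have ht0 : 0 < t := by linarith
  have ht1 : t < 1 := by linarith
  set D := ‖x - y‖ with hD
  have h₁ := h.le (x + t • (y - x)) y
  have e₁ : ‖x + t • (y - x) - y‖ = (1 - t) * D := by
    have : x + t • (y - x) - y = (1 - t) • (x - y) := by module
    rw [this, norm_smul, Real.norm_of_nonneg (by linarith)]
  rw [e₁] at h₁
  have h₂ := hX (x + t • (y - x))
  have e₂ : ‖x + t • (y - x) - X‖ ≤ r + t * D := by
    calc ‖x + t • (y - x) - X‖ = ‖(x - X) + t • (y - x)‖ := by congr 1; abel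
      _ ≤ ‖x - X‖ + ‖t • (y - x)‖ := norm_add_le _ _
      _ ≤ r + t * D := by
        rw [norm_smul, Real.norm_of_nonneg ht0.le, norm_sub_rev y x]
        linarith
  have h₃ := h.le_add_norm_sub hlip x X
  have e₃ : ((1 - t) * D) ^ 2 / (2 * ε) =
      D ^ 2 / (2 * ε) - (2 * t - t ^ 2) * (D ^ 2 / (2 * ε)) := by ring
  have h₄ : D / 2 ≤ D ^ 2 / (2 * ε) := by
    rw [div_le_div_iff₀ (by norm_num) (by positivity)]
    nlinarith
  have h₅ : (2 * t - t ^ 2) * (D / 2) ≤ (2 * t - t ^ 2) * (D ^ 2 / (2 * ε)) :=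
    mul_le_mul_of_nonneg_left h₄ (by nlinarith)
  have h₆ : τ * ‖x + t • (y - x) - X‖ ≤ τ * (r + t * D) := mul_le_mul_of_nonneg_left e₂ hτ.le
  have h₇ : (2 * t - t ^ 2) * (D / 2) < 2 * r + τ * (t * D) := by
    have hr0 : 0 < r := (norm_nonneg _).trans_lt hx
    nlinarith
  have h₈ : t ^ 2 * ε ≤ t ^ 2 * D := mul_le_mul_of_nonneg_left hge (by positivity)
  have e₄ : τ = 1 - t := by rw [ht]; ring
  rw [e₄] at h₇
  nlinarith

end IsInfConvolution

end InfConvolution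

/-! ### The convexity defect at a maximum point. -/

section Convexity

variable {n : ℕ}

/-- The cone bound keeps proximal steps shorter than `ε`, so the unconstrained inequality holds with
data at a point `y` close to `X`. The oscillation of `f` and the Lipschitz bound on `u` then freeze
the right-hand side. -/
theorem IsInfConvolution.isLaplaceSupersolutionOn {ε δ : ℝ}
    {f u v : EuclideanSpace ℝ (Fin n) → ℝ} (h : IsInfConvolution ε u v) (hε : 0 < ε) (hδ : 0 < δ)
    (hlip : ∀ x y, u x ≤ u y + ‖x - y‖) (hsup : IsDiscountedSupersolution δ f u)
    {τ r σ : ℝ} (hτ : 0 < τ) (hτ₁ : τ < 1) (hr : r ≤ ε * (1 - τ) ^ 2 / 4) (hrε : r ≤ ε)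
    {X : EuclideanSpace ℝ (Fin n)} (hX : ∀ z, v X - τ * ‖z - X‖ ≤ v z)
    (hf : ∀ z, ‖z - X‖ ≤ 3 * ε → |f z - f X| ≤ σ) :
    IsLaplaceSupersolutionOn v (Metric.ball X r) (f X - σ - δ * (u X + ε)) := by
  intro x hx ψ hψ hmin
  have hx' : ‖x - X‖ < r := by simpa [dist_eq_norm] using hx
  obtain ⟨y, hy⟩ := h.exists_eq x
  have hlt := h.norm_sub_lt hε hlip hτ hτ₁ hr hX hx' hy
  have h₁ := h.sub_le_neg_laplacian hε hsup hy hlt hψ hmin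
  have h₂ : ‖y - X‖ ≤ 3 * ε := by
    have := norm_sub_le_norm_sub_add_norm_sub y x X
    rw [norm_sub_rev y x] at this
    linarith
  have h₃ := (abs_le.mp (hf y h₂)).1
  have h₄ : u y ≤ u X + ε := by
    have hq : 0 ≤ ‖x - y‖ ^ 2 / (2 * ε) := by positivity
    linarith [h.le_self x, hlip x X]
  have h₅ := mul_le_mul_of_nonneg_left h₄ hδ.le
  linarith

/-- A subsolution satisfies both parts of the maximum, so neither regularization nor a cone
condition is needed here. -/
theorem IsDiscountedSubsolution.isLaplaceSupersolutionOn_neg {ε δ : ℝ}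
    {f u : EuclideanSpace ℝ (Fin n) → ℝ} (hδ : 0 < δ)
    (hlip : ∀ x y, u x ≤ u y + ‖x - y‖) (hsub : IsDiscountedSubsolution δ f u)
    {r σ : ℝ} (hrε : r ≤ ε) (hε : 0 < ε) {Z : EuclideanSpace ℝ (Fin n)}
    (hf : ∀ z, ‖z - Z‖ ≤ 3 * ε → |f z - f Z| ≤ σ) :
    IsLaplaceSupersolutionOn (fun x => -u x) (Metric.ball Z r)
      (-(f Z + σ - δ * (u Z - ε))) := by
  intro x hx ψ hψ hmin
  have hx' : ‖x - Z‖ < r := by simpa [dist_eq_norm] using hx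
  have hop := (le_max_left _ _).trans <| hsub.2 x (fun y => -1 * ψ y) (contDiff_const.mul hψ) <| by
    filter_upwards [hmin] with y hy
    linarith
  rw [laplacian_const_mul hψ] at hop
  have h₁ := (abs_le.mp (hf x (by linarith))).2
  have h₂ : u Z - ε ≤ u x := by
    have := hlip Z x
    rw [norm_sub_rev] at this
    linarith
  have h₃ := mul_le_mul_of_nonneg_left h₂ hδ.le
  linarith

/-- The lower cone bound at a maximum point of `τ u(ax + by) - a v(x) - b v(y)`. -/
theorem cone_le_of_isMax {u v : EuclideanSpace ℝ (Fin n) → ℝ}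
    (hlip : ∀ x y, u x ≤ u y + ‖x - y‖) {τ a : ℝ} (hτ : 0 < τ) (ha : 0 < a)
    {X c : EuclideanSpace ℝ (Fin n)}
    (hmax : ∀ x, τ * u (a • x + c) - a * v x ≤ τ * u (a • X + c) - a * v X)
    (z : EuclideanSpace ℝ (Fin n)) : v X - τ * ‖z - X‖ ≤ v z := by
  have h₁ := hmax z
  have h₂ := hlip (a • X + c) (a • z + c)
  have e : ‖a • X + c - (a • z + c)‖ = a * ‖z - X‖ := by
    have : a • X + c - (a • z + c) = a • (X - z) := by module
    rw [this, norm_smul, Real.norm_of_nonneg ha.le, norm_sub_rev]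
  rw [e] at h₂
  have h₃ := mul_le_mul_of_nonneg_left h₂ hτ.le
  have h₄ : a * (v X - τ * ‖z - X‖) ≤ a * v z := by linarith
  exact le_of_mul_le_mul_left h₄ ha

/-- The estimate obtained at a maximum point of the regularized convexity defect. -/
theorem discounted_defect_le [NeZero n] {ε δ : ℝ} {f u v : EuclideanSpace ℝ (Fin n) → ℝ}
    (hu : Continuous u) (h : IsInfConvolution ε u v) (hε : 0 < ε) (hδ : 0 < δ)
    (hlip : ∀ x y, u x ≤ u y + ‖x - y‖) (hsub : IsDiscountedSubsolution δ f u)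
    (hsup : IsDiscountedSupersolution δ f u) {τ a b σ : ℝ} (hτ : 0 < τ) (hτ₁ : τ < 1)
    (ha : 0 < a) (hb : 0 < b) (hab : a + b = 1) (hσ : 0 ≤ σ) {X Y : EuclideanSpace ℝ (Fin n)}
    (hmax : ∀ x y, τ * u (a • x + b • y) - a * v x - b * v y ≤
      τ * u (a • X + b • Y) - a * v X - b * v Y)
    (hfX : ∀ z, ‖z - X‖ ≤ 3 * ε → |f z - f X| ≤ σ)
    (hfY : ∀ z, ‖z - Y‖ ≤ 3 * ε → |f z - f Y| ≤ σ)
    (hfZ : ∀ z, ‖z - (a • X + b • Y)‖ ≤ 3 * ε → |f z - f (a • X + b • Y)| ≤ σ) :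
    δ * (τ * u (a • X + b • Y) - a * u X - b * u Y) ≤
      τ * f (a • X + b • Y) - a * f X - b * f Y + 2 * σ + 2 * δ * ε := by
  set Z := a • X + b • Y with hZ
  have hv := h.continuous hlip
  set r := min ε (ε * (1 - τ) ^ 2 / 4)
  have hr0 : 0 < r := lt_min hε (by have := sub_pos.mpr hτ₁; positivity)
  have hconeX : ∀ z, v X - τ * ‖z - X‖ ≤ v z :=
    cone_le_of_isMax hlip hτ ha (c := b • Y) fun x => by linarith [hmax x Y]
  have hconeY : ∀ z, v Y - τ * ‖z - Y‖ ≤ v z :=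
    cone_le_of_isMax hlip hτ hb (c := a • X) fun y => by
      rw [add_comm (b • y), add_comm (b • Y)]
      linarith [hmax X y]
  have sX := ((h.isLaplaceSupersolutionOn hε hδ hlip hsup hτ hτ₁ (min_le_right _ _)
    (min_le_left _ _) hconeX hfX).comp_add_right (r := r)).const_mul ha
  have sY := ((h.isLaplaceSupersolutionOn hε hδ hlip hsup hτ hτ₁ (min_le_right _ _)
    (min_le_left _ _) hconeY hfY).comp_add_right (r := r)).const_mul hb
  have sZ := ((hsub.isLaplaceSupersolutionOn_neg hδ hlip (r := r)
    (min_le_left _ _) hε hfZ).comp_add_right).const_mul hτ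
  -- Since `a + b = 1`, shifting `X` and `Y` by the same vector shifts `Z` by it too. Maximality of
  -- the defect along such common translations says that this sum has a minimum at the origin.
  have hsum := IsLaplaceSupersolutionOn.sum_nonpos (ι := Fin 3) hr0
    (w := ![fun x => τ * -u (x + Z), fun x => a * v (x + X), fun x => b * v (x + Y)])
    (b := ![τ * (-(f Z + σ - δ * (u Z - ε))), a * (f X - σ - δ * (u X + ε)),
      b * (f Y - σ - δ * (u Y + ε))])
    (fun i => by fin_cases i <;> simp <;> fun_prop)
    (fun i => by
      fin_cases i
      · exact sZ
      · exact sX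
      · exact sY)
    (Filter.Eventually.of_forall fun x => by
      have e : a • (x + X) + b • (x + Y) = x + Z := by
        have : a • (x + X) + b • (x + Y) = (a + b) • x + Z := by rw [hZ]; module
        rw [this, hab, one_smul]
      have := hmax (x + X) (x + Y)
      rw [e] at this
      simp [Fin.sum_univ_three]
      linarith)
  simp only [Fin.sum_univ_three, Matrix.cons_val] at hsum
  have h₁ : τ * (σ + δ * ε) ≤ 1 * (σ + δ * ε) :=
    mul_le_mul_of_nonneg_right hτ₁.le (by positivity)
  have h₂ : a * (σ + δ * ε) + b * (σ + δ * ε) = σ + δ * ε := by rw [← add_mul, hab, one_mul]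
  linarith

/-- A priori bound for the points where the regularized convexity defect is not too negative. -/
theorem exists_norm_le_of_le_defect {u : EuclideanSpace ℝ (Fin n) → ℝ} (hu : Continuous u)
    (hlip : ∀ x y, u x ≤ u y + ‖x - y‖)
    (hgrowth : Tendsto (fun x => u x / ‖x‖) (cocompact (EuclideanSpace ℝ (Fin n))) (𝓝 1))
    {τ a b : ℝ} (hτ : 0 < τ) (hτ₁ : τ < 1) (ha : 0 < a) (hb : 0 < b) (hab : a + b = 1) (m : ℝ) :
    ∃ R, ∀ x y, m ≤ τ * u (a • x + b • y) - a * u x - b * u y → ‖x‖ ≤ R ∧ ‖y‖ ≤ R := by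
  -- With the slope midway between `τ` and `1`, the defect is at most `τ u(0) + C - κ(a‖x‖ + b‖y‖)`.
  obtain ⟨C, hC⟩ := exists_mul_norm_sub_le hu hgrowth (a := (1 + τ) / 2) (by linarith)
  set κ := (1 - τ) / 2 with hκ
  have hκ0 : 0 < κ := by rw [hκ]; linarith
  set S := (τ * u 0 + C - m) / κ with hS
  refine ⟨max (S / a) (S / b), fun x y hxy => ?_⟩
  have h₁ : u (a • x + b • y) ≤ u 0 + (a * ‖x‖ + b * ‖y‖) := by
    have := hlip (a • x + b • y) 0
    have h' : ‖a • x + b • y‖ ≤ a * ‖x‖ + b * ‖y‖ := by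
      refine (norm_add_le _ _).trans_eq ?_
      rw [norm_smul, norm_smul, Real.norm_of_nonneg ha.le, Real.norm_of_nonneg hb.le]
    rw [sub_zero] at this
    linarith
  have h₂ := mul_le_mul_of_nonneg_left h₁ hτ.le
  have h₃ := mul_le_mul_of_nonneg_left (hC x) ha.le
  have h₄ := mul_le_mul_of_nonneg_left (hC y) hb.le
  have h₅ : a * C + b * C = C := by rw [← add_mul, hab, one_mul]
  have h₆ : a * ‖x‖ + b * ‖y‖ ≤ S := by
    rw [hS, le_div_iff₀ hκ0, hκ]
    linarith
  have hx : 0 ≤ a * ‖x‖ := by positivity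
  have hy : 0 ≤ b * ‖y‖ := by positivity
  constructor
  · refine le_max_of_le_left ((le_div_iff₀ ha).mpr ?_)
    linarith
  · refine le_max_of_le_right ((le_div_iff₀ hb).mpr ?_)
    linarith

/-- The bound on the right is the cost of the factor `τ`: convexity of `f` leaves `-(1 - τ) f(Z)`.
The regularization errors vanish as `θ → 0`. -/
theorem scaled_defect_le [NeZero n] {δ : ℝ} {f u : EuclideanSpace ℝ (Fin n) → ℝ}
    (hf : Continuous f) (hfc : ConvexOn ℝ Set.univ f) {K : ℝ} (hK : ∀ x, -K ≤ f x)
    (hu : Continuous u) (hδ : 0 < δ)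
    (hgrowth : Tendsto (fun x => u x / ‖x‖) (cocompact (EuclideanSpace ℝ (Fin n))) (𝓝 1))
    (hsub : IsDiscountedSubsolution δ f u) (hsup : IsDiscountedSupersolution δ f u)
    {τ a b : ℝ} (hτ : 0 < τ) (hτ₁ : τ < 1) (ha : 0 < a) (hb : 0 < b) (hab : a + b = 1)
    (x₀ y₀ : EuclideanSpace ℝ (Fin n)) :
    δ * (τ * u (a • x₀ + b • y₀) - a * u x₀ - b * u y₀) ≤ (1 - τ) * K := by
  have hlip := hsub.le_add_norm_sub hu hgrowth
  set m := τ * u (a • x₀ + b • y₀) - a * u x₀ - b * u y₀ with hm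
  -- The slack `1/2` absorbs the error `ε/2` of replacing `u` by `v`, as `ε ≤ 1`; thus `R` does not
  -- depend on `ε`.
  obtain ⟨R, hR⟩ := exists_norm_le_of_le_defect hu hlip hgrowth hτ hτ₁ ha hb hab (m - 1 / 2)
  have key (θ : ℝ) (hθ : 0 < θ) : δ * m ≤ (1 - τ) * K + (2 + 3 * δ) * θ := by
    have hunif := (isCompact_closedBall (0 : EuclideanSpace ℝ (Fin n))
      (R + 3)).uniformContinuousOn_of_continuous hf.continuousOn
    obtain ⟨ε₀, hε₀, hmod⟩ := Metric.uniformContinuousOn_iff_le.mp hunif θ hθ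
    set ε := min (min 1 θ) (ε₀ / 3) with hεdef
    have hε : 0 < ε := lt_min (lt_min one_pos hθ) (by positivity)
    have hε₁ : ε ≤ 1 := (min_le_left _ _).trans (min_le_left _ _)
    have hεθ : ε ≤ θ := (min_le_left _ _).trans (min_le_right _ _)
    have hε3 : 3 * ε ≤ ε₀ := by linarith [min_le_right (min 1 θ) (ε₀ / 3)]
    have hosc (X : EuclideanSpace ℝ (Fin n)) (hX : ‖X‖ ≤ R) (z : EuclideanSpace ℝ (Fin n))
        (hz : ‖z - X‖ ≤ 3 * ε) : |f z - f X| ≤ θ := by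
      have hz' : ‖z‖ ≤ R + 3 := by
        have := norm_le_norm_add_norm_sub' z X
        linarith
      have := hmod z (by simpa using hz') X (by simpa using hX.trans (by linarith))
        (by rw [dist_eq_norm]; linarith)
      rwa [Real.dist_eq] at this
    obtain ⟨v, hv⟩ := exists_isInfConvolution hu hlip hε
    have hvc := hv.continuous hlip
    let Φ : EuclideanSpace ℝ (Fin n) × EuclideanSpace ℝ (Fin n) → ℝ := fun p =>
      τ * u (a • p.1 + b • p.2) - a * v p.1 - b * v p.2
    have hΦ : Continuous Φ := by fun_prop
    have hlow (x) := hv.self_sub_le hε hlip x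
    have hΦu (p : EuclideanSpace ℝ (Fin n) × EuclideanSpace ℝ (Fin n)) :
        Φ p ≤ τ * u (a • p.1 + b • p.2) - a * u p.1 - b * u p.2 + ε / 2 := by
      have h₁ := mul_le_mul_of_nonneg_left (hlow p.1) ha.le
      have h₂ := mul_le_mul_of_nonneg_left (hlow p.2) hb.le
      have h₃ : a * (ε / 2) + b * (ε / 2) = ε / 2 := by rw [← add_mul, hab, one_mul]
      simp only [Φ]
      linarith
    have hΦ0 : m ≤ Φ (x₀, y₀) := by
      have h₁ := mul_le_mul_of_nonneg_left (hv.le_self x₀) ha.le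
      have h₂ := mul_le_mul_of_nonneg_left (hv.le_self y₀) hb.le
      simp only [Φ]
      linarith
    obtain ⟨⟨X, Y⟩, hXY⟩ := hΦ.exists_forall_ge' (x₀, y₀) (by
      filter_upwards [(tendsto_norm_cocompact_atTop
        (E := EuclideanSpace ℝ (Fin n) × EuclideanSpace ℝ (Fin n))).eventually_gt_atTop R]
        with p hp
      by_contra! hlt
      have := hR p.1 p.2 (by linarith [hΦu p])
      exact absurd (max_le this.1 this.2) (not_le.mpr hp))
    have hM : m ≤ Φ (X, Y) := hΦ0.trans (hXY _)
    have hM' := hM.trans (hΦu (X, Y))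
    dsimp only at hM'
    obtain ⟨hX, hY⟩ := hR X Y (by linarith)
    have hZ : ‖a • X + b • Y‖ ≤ R := by
      refine (norm_add_le _ _).trans ?_
      rw [norm_smul, norm_smul, Real.norm_of_nonneg ha.le, Real.norm_of_nonneg hb.le]
      calc a * ‖X‖ + b * ‖Y‖ ≤ a * R + b * R := by gcongr
        _ = R := by rw [← add_mul, hab, one_mul]
    have hest := discounted_defect_le hu hv hε hδ hlip hsub hsup hτ hτ₁ ha hb hab hθ.le
      (fun x y => hXY (x, y)) (hosc X hX) (hosc Y hY) (hosc _ hZ)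
    have hconv := hfc.2 (Set.mem_univ X) (Set.mem_univ Y) ha.le hb.le hab
    simp only [smul_eq_mul] at hconv
    have h₁ : (1 - τ) * -K ≤ (1 - τ) * f (a • X + b • Y) :=
      mul_le_mul_of_nonneg_left (hK _) (by linarith)
    have h₂ := mul_le_mul_of_nonneg_left hM' hδ.le
    have h₃ := mul_le_mul_of_nonneg_left hεθ hδ.le
    nlinarith
  by_contra! hlt
  have hpos : 0 < 2 + 3 * δ := by positivity
  have := key ((δ * m - (1 - τ) * K) / (2 * (2 + 3 * δ))) (div_pos (by linarith) (by positivity))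
  have e : (2 + 3 * δ) * ((δ * m - (1 - τ) * K) / (2 * (2 + 3 * δ))) =
      (δ * m - (1 - τ) * K) / 2 := by field_simp
  rw [e] at this
  linarith

theorem exists_neg_le_of_growth {E : Type*} [NormedAddCommGroup E] {f : E → ℝ}
    (hf : Continuous f) (hgrowth : Tendsto (fun x => f x / ‖x‖) (cocompact E) atTop) :
    ∃ K, ∀ x, -K ≤ f x := by
  obtain ⟨S, hS, hsub⟩ := mem_cocompact.mp (hgrowth.eventually_ge_atTop 0)
  obtain ⟨C, hC⟩ := hS.bddBelow_image hf.continuousOn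
  refine ⟨max (-C) (max 0 (-f 0)), fun x => ?_⟩
  by_cases hx : x ∈ S
  · linarith [hC (Set.mem_image_of_mem f hx), le_max_left (-C) (max 0 (-f 0))]
  · have h₁ := le_max_right (-C) (max 0 (-f 0))
    rcases eq_or_ne x 0 with rfl | h0
    · linarith [le_max_right 0 (-f 0)]
    · have h₂ : 0 ≤ f x / ‖x‖ := hsub hx
      have h₃ : 0 ≤ f x := by
        have := mul_nonneg h₂ (norm_nonneg x)
        rwa [div_mul_cancel₀ _ (norm_ne_zero_iff.mpr h0)] at this
      linarith [le_max_left 0 (-f 0)]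

end Convexity

theorem lemma3p4 (n : ℕ) (f : EuclideanSpace ℝ (Fin n) → ℝ)
    (hf_smooth : ContDiff ℝ ∞ f) (hf_convex : ConvexOn ℝ Set.univ f)
    (hf_growth : Tendsto (fun x => f x / ‖x‖) (cocompact (EuclideanSpace ℝ (Fin n))) atTop)
    (δ : ℝ) (hδ : 0 < δ)
    (u : EuclideanSpace ℝ (Fin n) → ℝ) (hu : IsDiscountedSolution δ f u)
    (hu_growth : Tendsto (fun x => u x / ‖x‖) (cocompact (EuclideanSpace ℝ (Fin n))) (𝓝 1)) :
    ConvexOn ℝ Set.univ u := by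
  obtain ⟨hcont, hsub, hsup⟩ := hu
  refine convexOn_iff_forall_pos.mpr ⟨convex_univ, fun x _ y _ a b ha hb hab => ?_⟩
  -- In dimension zero the space is a point; the comparison argument divides by `n`.
  rcases Nat.eq_zero_or_pos n with rfl | hn
  · have hx : a • x + b • y = x := Subsingleton.elim _ _
    have hy : y = x := Subsingleton.elim _ _
    rw [hx, hy, ← add_smul, hab, one_smul]
  · have : NeZero n := ⟨hn.ne'⟩
    obtain ⟨K, hK⟩ := exists_neg_le_of_growth hf_smooth.continuous hf_growth
    -- The bound for `τ < 1` passes to the limit `τ → 1`, where the term with `K` disappears.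
    set g : ℝ → ℝ := fun τ => (1 - τ) * K - δ * (τ * u (a • x + b • y) - a * u x - b * u y)
    have hg : Continuous g := by fun_prop
    have hnonneg : ∀ᶠ τ in 𝓝[<] (1 : ℝ), 0 ≤ g τ := by
      filter_upwards [Ioo_mem_nhdsLT one_pos] with τ hτ
      exact sub_nonneg.mpr (scaled_defect_le hf_smooth.continuous hf_convex hK hcont hδ hu_growth
        hsub hsup hτ.1 hτ.2 ha hb hab x y)
    have h₁ : 0 ≤ g 1 := ge_of_tendsto (hg.continuousAt.tendsto.mono_left nhdsWithin_le_nhds) hnonneg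
    simp only [g, sub_self, zero_mul, one_mul, zero_sub] at h₁
    have h₂ : u (a • x + b • y) - a * u x - b * u y ≤ 0 := by
      by_contra! h
      linarith [mul_pos hδ h]
    simp only [smul_eq_mul]
    linarith
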